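/- Let $d\ge 1$, let $G=(V,E)$ be a finite simple graph, let $u,v\in V$, and let $V_0\subseteq V$ be such that $u,v\in V_0$ and the induced subgraph $G[V_0]$ is rigid in $\mathbb{R}^d$ (that is, $G[V_0]$ is a $(u,v)$-rigid subgraph of $G$). Let $e=s_1s_2\in E$ be an edge of $G$ that is not an edge of $G[V_0]$, i.e. $s_1$ and $s_2$ are not both in $V_0$. Let $G/e$ be the simple graph obtained from $G$ by identifying $s_1$ and $s_2$ and removing the loops and parallel edges that arise. If $\{u,v\}$ is weakly globally linked in $G/e$ in $\mathbb{R}^d$ (where $u,v$ denote also their images in $G/e$), then $\{u,v\}$ is weakly globally linked in $G$ in $\mathbb{R}^d$. Here a framework $(H,p)$ is a graph $H$ with a map $p:V(H)\to\mathbb{R}^d$; it is generic if its $d|V(H)|$ vertex coordinates are algebraically independent over $\mathbb{Q}$. Frameworks $(H,p)$ and $(H,q)$ are equivalent if $\|p(x)-p(y)\|=\|q(x)-q(y)\|$ (Euclidean norm) for all edges $xy$ of $H$, and congruent if this holds for all $x,y\in V(H)$. The framework $(H,p)$ is rigid if there is $\varepsilon>0$ such that every $(H,q)$ equivalent to $(H,p)$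 with $\|p(x)-q(x)\|<\varepsilon$ for all $x\in V(H)$ is congruent to $(H,p)$; the graph $H$ is rigid in $\mathbb{R}^d$ if every generic framework $(H,p)$ in $\mathbb{R}^d$ is rigid. The pair $\{u,v\}$ is globally linked in $(H,p)$ if $\|p(u)-p(v)\|=\|q(u)-q(v)\|$ for every $(H,q)$ in $\mathbb{R}^d$ equivalent to $(H,p)$, and it is weakly globally linked in $H$ in $\mathbb{R}^d$ if it is globally linked in some generic framework $(H,p)$ in $\mathbb{R}^d$. -/

import Mathlib

namespace GraphRigidity

/-- A `d`-dimensional configuration of `V`; a framework is a graph on `V` with such a map. -/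
abbrev Config (V : Type*) (d : ℕ) := V → EuclideanSpace ℝ (Fin d)

section

variable {V : Type*} {d : ℕ}

/-- The `d|V|` vertex coordinates are algebraically independent over `ℚ`. -/
def Generic (p : Config V d) : Prop :=
  AlgebraicIndependent ℚ (fun c : V × Fin d => p c.1 c.2)

/-- The frameworks `(G, p)` and `(G, q)` have the same edge lengths. -/
def Equivalent (G : SimpleGraph V) (p q : Config V d) : Prop :=
  ∀ x y : V, G.Adj x y → ‖p x - p y‖ = ‖q x - q y‖

/-- The configurations `p` and `q` have the same pairwise distances. -/
def Congruent (p q : Config V d) : Prop :=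
  ∀ x y : V, ‖p x - p y‖ = ‖q x - q y‖

/-- The framework `(G, p)` is rigid: every equivalent framework close to it is congruent to it. -/
def RigidFramework (G : SimpleGraph V) (p : Config V d) : Prop :=
  ∃ ε : ℝ, 0 < ε ∧ ∀ q : Config V d,
    Equivalent G p q → (∀ x : V, ‖p x - q x‖ < ε) → Congruent p q

/-- `G` is rigid in `ℝ^d`: every generic realization of `G` in `ℝ^d` is rigid. -/
def Rigid (d : ℕ) (G : SimpleGraph V) : Prop :=
  ∀ p : Config V d, Generic p → RigidFramework G p

/-- The induced subgraph `G[X]` is `(u,v)`-rigid in `ℝ^d`. -/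
def PairRigid (d : ℕ) (G : SimpleGraph V) (X : Set V) (u v : V) : Prop :=
  Rigid d (G.induce X) ∧ u ∈ X ∧ v ∈ X

/-- `{u,v}` is globally linked in the framework `(G, p)`. -/
def GloballyLinkedIn (G : SimpleGraph V) (p : Config V d) (u v : V) : Prop :=
  ∀ q : Config V d, Equivalent G p q → ‖p u - p v‖ = ‖q u - q v‖

/-- `{u,v}` is weakly globally linked in `G` in `ℝ^d`. -/
def WeaklyGloballyLinked (d : ℕ) (G : SimpleGraph V) (u v : V) : Prop :=
  ∃ p : Config V d, Generic p ∧ GloballyLinkedIn G p u v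

/-- The equivalence relation on `V` that identifies all elements of `S` and nothing else. -/
def contractSetoid (S : Set V) : Setoid V where
  r x y := x = y ∨ (x ∈ S ∧ y ∈ S)
  iseqv :=
    { refl := fun _ => Or.inl rfl
      symm := by
        rintro x y (h | ⟨hx, hy⟩)
        · exact Or.inl h.symm
        · exact Or.inr ⟨hy, hx⟩
      trans := by
        rintro x y z (rfl | ⟨hx, hy⟩) (rfl | ⟨hy', hz⟩)
        · exact Or.inl rfl
        · exact Or.inr ⟨hy', hz⟩
        · exact Or.inr ⟨hx, hy⟩
        · exact Or.inr ⟨hx, hz⟩ }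

/-- The vertex set of `G/S`. -/
abbrev ContractVertex (S : Set V) : Type _ := Quotient (contractSetoid S)

/-- The vertex of `G/S` that a vertex of `G` becomes. -/
def contractMk (S : Set V) (x : V) : ContractVertex S := Quotient.mk (contractSetoid S) x

/-- The contraction `G/S`: the elements of `S` are identified, loops and parallel edges removed. -/
def contract (G : SimpleGraph V) (S : Set V) : SimpleGraph (ContractVertex S) :=
  G.map (contractMk S)

end

end GraphRigidity

/-! A generic framework of `G/e` pulls back to a framework of `G` in which `e` has length zero.
Every equivalent framework also collapses `e`, hence descends to `G/e`, so the pair stays globally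
linked (`GloballyLinkedIn.of_contract`). The pullback is in general not generic, but it is generic
on `V₀`, which misses an end of `e`.

It remains to perturb outside `V₀` (`GloballyLinkedIn.weaklyGloballyLinked`). If the pair were
linked in no generic framework, generic `P n → p` would have equivalent `Q n` with a wrong
`uv`-distance. Rigidity of `G[V₀]` allows only finitely many distances (`Rigid.finite_dist`), so the
wrong ones stay away from the right one, and a limit of translated `Q n` contradicts linkedness at
`p`.

Finiteness holds because the squared distance is algebraic over the squared edge lengths: otherwise
the inverse function theorem would vary it near `p` with the edge lengths fixed. -/

open Filter Topology MvPolynomial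

/-! ### Fibres of polynomial maps through generic points -/

section GenericPoints

/-- An element of a domain of characteristic zero that is algebraic over a subring is a simple root
of a polynomial over that subring. -/
theorem IsAlgebraic.exists_aeval_derivative_ne_zero {A R : Type*} [CommRing A] [CommRing R]
    [IsDomain R] [Algebra A R] [FaithfulSMul A R] [CharZero R] {x : R} (hx : IsAlgebraic A x) :
    ∃ Q : Polynomial A, Polynomial.aeval x Q = 0 ∧
      Polynomial.aeval x (Polynomial.derivative Q) ≠ 0 := by
  classical
  have hinj : Function.Injective (algebraMap A R) := FaithfulSMul.algebraMap_injective A R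
  have : IsDomain A := hinj.isDomain (algebraMap A R)
  have : CharZero A := ⟨fun m n hmn => Nat.cast_injective (R := R) (by
    simpa using congrArg (algebraMap A R) hmn)⟩
  -- A relation of minimal degree works: its derivative is nonzero of smaller degree.
  have hex : ∃ n, ∃ Q : Polynomial A, Q ≠ 0 ∧ Polynomial.aeval x Q = 0 ∧ Q.natDegree = n := by
    obtain ⟨Q, hQ, h0⟩ := hx
    exact ⟨_, Q, hQ, h0, rfl⟩
  obtain ⟨Q, hQ, h0, hdeg⟩ := Nat.find_spec hex
  refine ⟨Q, h0, fun h1 => ?_⟩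
  have hpos : Q.natDegree ≠ 0 := by
    intro hd
    rw [Polynomial.eq_C_of_natDegree_eq_zero hd, Polynomial.aeval_C] at h0
    have h2 : Q.coeff 0 = 0 := hinj (by simpa using h0)
    rw [Polynomial.eq_C_of_natDegree_eq_zero hd, h2] at hQ
    simp at hQ
  have hd0 : Polynomial.derivative Q ≠ 0 := fun h =>
    hpos (Polynomial.derivative_eq_zero.1 h)
  have hlt := Polynomial.natDegree_derivative_lt hpos
  exact Nat.find_min hex (hdeg ▸ hlt) ⟨_, hd0, h1, rfl⟩

variable {σ : Type*}

/-- If `p` and `q` agree on the polynomials of `S`, they agree on the subalgebra generated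
by `S`. -/
theorem MvPolynomial.aeval_eq_of_mem_adjoin {S : Set (MvPolynomial σ ℚ)} {p q : σ → ℝ}
    (h : ∀ s ∈ S, aeval q s = aeval p s) {a : MvPolynomial σ ℚ} (ha : a ∈ Algebra.adjoin ℚ S) :
    aeval q a = aeval p a := by
  have : Algebra.adjoin ℚ S ≤ AlgHom.equalizer (aeval q : _ →ₐ[ℚ] ℝ) (aeval p) :=
    Algebra.adjoin_le h
  exact this ha

/-- On the fibre through a generic point `p` of the polynomials in `S`, a polynomial algebraic
over `S` takes only finitely many values. -/
theorem AlgebraicIndependent.finite_values_on_fibre {p : σ → ℝ} (hp : AlgebraicIndependent ℚ p)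
    {S : Set (MvPolynomial σ ℚ)} {h : MvPolynomial σ ℚ}
    (hh : IsAlgebraic (Algebra.adjoin ℚ S) h) :
    {r : ℝ | ∃ q : σ → ℝ, (∀ s ∈ S, aeval q s = aeval p s) ∧ aeval q h = r}.Finite := by
  obtain ⟨Q, hQ, h0⟩ := hh
  let φ : (σ → ℝ) → (Algebra.adjoin ℚ S →+* ℝ) := fun q =>
    ((aeval q : MvPolynomial σ ℚ →ₐ[ℚ] ℝ) : MvPolynomial σ ℚ →+* ℝ).comp
      (algebraMap (Algebra.adjoin ℚ S) (MvPolynomial σ ℚ))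
  -- Genericity keeps the specialised relation nonzero.
  have hφ : Function.Injective (φ p) :=
    (algebraicIndependent_iff_injective_aeval.1 hp).comp Subtype.val_injective
  have hne : Q.map (φ p) ≠ 0 := (Polynomial.map_ne_zero_iff hφ).2 hQ
  refine (Polynomial.finite_setOfPred_isRoot hne).subset ?_
  rintro r ⟨q, hq, rfl⟩
  have hqp : φ q = φ p := RingHom.ext fun a => MvPolynomial.aeval_eq_of_mem_adjoin hq a.2
  have := congrArg (aeval q : MvPolynomial σ ℚ →ₐ[ℚ] ℝ) h0
  rw [map_zero, Polynomial.aeval_def] at this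
  change Polynomial.eval _ _ = 0
  rw [← hqp, Polynomial.eval_map]
  rw [← AlgHom.coe_toRingHom, Polynomial.hom_eval₂] at this
  exact this

/-! ### Directional derivatives and openness -/

/-- The derivative at `p` in direction `w`. -/
noncomputable def MvPolynomial.dirDeriv [Fintype σ] (p w : σ → ℝ) (h : MvPolynomial σ ℚ) : ℝ :=
  fderiv ℝ (fun x : σ → ℝ => aeval x h) p w

variable [Fintype σ]

theorem MvPolynomial.hasStrictFDerivAt_aeval (h : MvPolynomial σ ℚ) (p : σ → ℝ) :
    HasStrictFDerivAt (fun x : σ → ℝ => aeval x h) (fderiv ℝ (fun x : σ → ℝ => aeval x h) p) p :=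
  (AnalyticAt.aeval_mvPolynomial (𝕜 := ℝ) (f := fun x : σ → ℝ => x)
    (fun i => (ContinuousLinearMap.proj (R := ℝ) (φ := fun _ : σ => ℝ) i).analyticAt p)
    h).hasStrictFDerivAt

namespace MvPolynomial

variable (p w : σ → ℝ)

theorem dirDeriv_add (g h : MvPolynomial σ ℚ) :
    dirDeriv p w (g + h) = dirDeriv p w g + dirDeriv p w h := by
  simp only [dirDeriv, map_add]
  rw [fderiv_fun_add (hasStrictFDerivAt_aeval g p).differentiableAt
    (hasStrictFDerivAt_aeval h p).differentiableAt]
  rfl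

theorem dirDeriv_mul (g h : MvPolynomial σ ℚ) :
    dirDeriv p w (g * h) = aeval p g * dirDeriv p w h + aeval p h * dirDeriv p w g := by
  simp only [dirDeriv, map_mul]
  rw [fderiv_fun_mul (hasStrictFDerivAt_aeval g p).differentiableAt
    (hasStrictFDerivAt_aeval h p).differentiableAt]
  rfl

theorem dirDeriv_algebraMap (c : ℚ) :
    dirDeriv p w (algebraMap ℚ (MvPolynomial σ ℚ) c) = 0 := by
  simp [dirDeriv]

theorem dirDeriv_X (i : σ) : dirDeriv p w (X i) = w i := by
  simp only [dirDeriv, aeval_X]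
  exact congrArg (fun L : (σ → ℝ) →L[ℝ] ℝ => L w)
    (ContinuousLinearMap.proj (R := ℝ) (φ := fun _ : σ => ℝ) i).hasFDerivAt.fderiv

theorem dirDeriv_pow (g : MvPolynomial σ ℚ) (n : ℕ) :
    dirDeriv p w (g ^ n) = n * aeval p g ^ (n - 1) * dirDeriv p w g := by
  induction n with
  | zero => simpa using dirDeriv_algebraMap p w 1
  | succ n ih =>
    rw [pow_succ, dirDeriv_mul, ih]
    rcases n with _ | n
    · simp
    · simp only [map_pow, Nat.add_sub_cancel]
      push_cast
      ring

variable {p w}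

theorem dirDeriv_eq_zero_of_mem_adjoin {S : Set (MvPolynomial σ ℚ)}
    (hS : ∀ s ∈ S, dirDeriv p w s = 0) {a : MvPolynomial σ ℚ} (ha : a ∈ Algebra.adjoin ℚ S) :
    dirDeriv p w a = 0 := by
  induction ha using Algebra.adjoin_induction with
  | mem x hx => exact hS x hx
  | algebraMap r => exact dirDeriv_algebraMap p w r
  | add x y _ _ hx hy => rw [dirDeriv_add, hx, hy, add_zero]
  | mul x y _ _ hx hy => rw [dirDeriv_mul, hx, hy, mul_zero, mul_zero, add_zero]

/-- Chain rule: the coefficients, being generated by `S`, behave as constants in direction `w`. -/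
theorem dirDeriv_aeval {S : Set (MvPolynomial σ ℚ)} (hS : ∀ s ∈ S, dirDeriv p w s = 0)
    (g : MvPolynomial σ ℚ) (Q : Polynomial (Algebra.adjoin ℚ S)) :
    dirDeriv p w (Polynomial.aeval g Q) =
      aeval p (Polynomial.aeval g (Polynomial.derivative Q)) * dirDeriv p w g := by
  induction Q using Polynomial.induction_on' with
  | add P Q hP hQ => simp only [map_add, dirDeriv_add, hP, hQ, add_mul]
  | monomial n a =>
    have ha := dirDeriv_eq_zero_of_mem_adjoin hS a.2
    rw [Polynomial.aeval_monomial, Polynomial.derivative_monomial, Polynomial.aeval_monomial,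
      dirDeriv_mul, dirDeriv_pow]
    rw [show dirDeriv p w (algebraMap _ _ a) = 0 from ha]
    simp only [map_mul, map_pow, map_natCast]
    ring

/-- The evaluation map of a transcendence basis is open at a generic point. -/
theorem map_nhds_eq_of_isTranscendenceBasis {p : σ → ℝ} (hp : AlgebraicIndependent ℚ p)
    {T : Set (MvPolynomial σ ℚ)} (hT : IsTranscendenceBasis ℚ ((↑) : T → MvPolynomial σ ℚ)) :
    Filter.map (fun (x : σ → ℝ) (t : T) => aeval x (t : MvPolynomial σ ℚ)) (𝓝 p) =
      𝓝 (fun t : T => aeval p (t : MvPolynomial σ ℚ)) := by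
  -- Equal cardinality with the basis of variables makes the Jacobian square.
  have hcard := (IsTranscendenceBasis.mvPolynomial σ ℚ).lift_cardinalMk_eq hT
  have hfin : Finite T := by
    have h1 := Cardinal.mk_lt_aleph0 (α := σ)
    rw [← Cardinal.lift_lt_aleph0, hcard, Cardinal.lift_lt_aleph0] at h1
    exact Cardinal.mk_lt_aleph0_iff.1 h1
  have := Fintype.ofFinite T
  let F' : (σ → ℝ) →L[ℝ] (T → ℝ) :=
    ContinuousLinearMap.pi fun t : T => fderiv ℝ (fun x : σ → ℝ => aeval x (t : MvPolynomial σ ℚ)) p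
  have hF : HasStrictFDerivAt (fun (x : σ → ℝ) (t : T) => aeval x (t : MvPolynomial σ ℚ)) F' p :=
    hasStrictFDerivAt_pi.2 fun t => hasStrictFDerivAt_aeval _ p
  refine hF.map_nhds_eq_of_surj ?_
  -- Differentiating a simple algebraic relation for `X i` over `T` forces `w i = 0`; genericity
  -- keeps the other factor nonzero at `p`.
  have hinj : Function.Injective F' := by
    refine (injective_iff_map_eq_zero F').2 fun w hw => ?_
    funext i
    have hS : ∀ s ∈ Set.range ((↑) : T → MvPolynomial σ ℚ), dirDeriv p w s = 0 := by
      rintro _ ⟨t, rfl⟩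
      exact congrFun hw t
    obtain ⟨Q, h0, h1⟩ := (hT.isAlgebraic.isAlgebraic (X i)).exists_aeval_derivative_ne_zero
    have h2 := dirDeriv_aeval hS (X i) Q
    rw [h0, dirDeriv_X] at h2
    have h3 : dirDeriv p w 0 = 0 := by simpa using dirDeriv_algebraMap p w 0
    rw [h3, zero_eq_mul] at h2
    refine h2.resolve_left fun h4 => h1 (hp ?_)
    rw [h4, map_zero]
  have hrank : Module.finrank ℝ (σ → ℝ) = Module.finrank ℝ (T → ℝ) := by
    have := congrArg Cardinal.toNat hcard
    simpa [Nat.card_eq_fintype_card] using this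
  exact LinearMap.range_eq_top.2
    ((LinearMap.injective_iff_surjective_of_finrank_eq_finrank hrank).1 hinj)

end MvPolynomial

/-- If `h` is not algebraic over the finitely many polynomials of `S`, then arbitrarily close to
a generic point `p` there is a point with the same values on `S` and another value of `h`. -/
theorem AlgebraicIndependent.exists_near_of_transcendental {p : σ → ℝ}
    (hp : AlgebraicIndependent ℚ p) {S : Set (MvPolynomial σ ℚ)} (hSfin : S.Finite)
    {h : MvPolynomial σ ℚ} (hh : ¬ IsAlgebraic (Algebra.adjoin ℚ S) h)
    {U : Set (σ → ℝ)} (hU : U ∈ 𝓝 p) :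
    ∃ q ∈ U, (∀ s ∈ S, aeval q s = aeval p s) ∧ aeval q h ≠ aeval p h := by
  classical
  obtain ⟨B, hB⟩ := (AlgebraicIndependent.matroid ℚ (MvPolynomial σ ℚ)).exists_isBasis S
  have hBh := mt (AlgebraicIndependent.isAlgebraic_adjoin_iff_of_matroid_isBasis hB).1 hh
  obtain ⟨hBind, hBS, hSB⟩ := AlgebraicIndependent.matroid_isBasis_iff.1 hB
  have hins : AlgebraicIndepOn ℚ id (insert h B) := by
    refine AlgebraicIndepOn.insert hBind ?_
    rwa [Set.image_id]
  obtain ⟨T, hBT, hT⟩ := exists_isTranscendenceBasis_superset hins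
  have hhT : h ∈ T := hBT (Set.mem_insert _ _)
  have hhB : h ∉ B := fun hmem => hBh
    (isAlgebraic_algebraMap (⟨h, Algebra.subset_adjoin hmem⟩ : Algebra.adjoin ℚ B))
  have hopen := MvPolynomial.map_nhds_eq_of_isTranscendenceBasis hp hT
  -- Near `p`, fixing the values on `B` fixes the values on `S`.
  have hnear : ∀ᶠ q in 𝓝 p, ∀ s ∈ S, (∀ b ∈ B, aeval q b = aeval p b) →
      aeval q s = aeval p s := by
    rw [eventually_all_finite hSfin]
    intro s hs
    -- The other values on the fibre are finitely many, so continuity excludes them near `p`.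
    have hfin := hp.finite_values_on_fibre (hSB s hs)
    have hcont : ContinuousAt (fun x : σ → ℝ => aeval x s) p :=
      (MvPolynomial.hasStrictFDerivAt_aeval s p).continuousAt
    have hclosed := (hfin.subset (Set.sdiff_subset (t := {aeval p s}))).isClosed
    have hmem := hclosed.isOpen_compl.mem_nhds (x := aeval p s) (by simp)
    filter_upwards [hcont hmem] with q hq hqB
    by_contra hne
    exact hq ⟨⟨q, hqB, rfl⟩, hne⟩
  have himg : (fun (x : σ → ℝ) (t : T) => aeval x (t : MvPolynomial σ ℚ)) ''
      (U ∩ {q | ∀ s ∈ S, (∀ b ∈ B, aeval q b = aeval p b) → aeval q s = aeval p s}) ∈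
      𝓝 (fun t : T => aeval p (t : MvPolynomial σ ℚ)) :=
    hopen ▸ image_mem_map (inter_mem hU hnear)
  -- Only the value of `h` moves; openness lifts this path to points near `p`.
  let γ : ℝ → T → ℝ := fun c =>
    Function.update (fun t : T => aeval p (t : MvPolynomial σ ℚ)) ⟨h, hhT⟩ c
  have hγ : Tendsto γ (𝓝 (aeval p h)) (𝓝 (fun t : T => aeval p (t : MvPolynomial σ ℚ))) := by
    have : Continuous γ := continuous_const.update _ continuous_id
    have h2 := this.tendsto (aeval p h)
    rwa [show γ (aeval p h) = _ from Function.update_eq_self _ _] at h2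
  have hev : ∀ᶠ c in 𝓝[≠] (aeval p h), γ c ∈ _ := (hγ.mono_left nhdsWithin_le_nhds) himg
  obtain ⟨c, ⟨q, ⟨hqU, hqS⟩, hqc⟩, hc⟩ := (hev.and self_mem_nhdsWithin).exists
  refine ⟨q, hqU, fun s hs => hqS s hs fun b hb => ?_, ?_⟩
  · have := congrFun hqc ⟨b, hBT (Set.mem_insert_of_mem _ hb)⟩
    rwa [show γ c _ = _ from Function.update_of_ne (by
      intro heq; exact hhB (Subtype.mk.inj heq ▸ hb)) _ _] at this
  · have := congrFun hqc ⟨h, hhT⟩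
    rw [show γ c _ = _ from Function.update_self _ _ _] at this
    exact fun heq => hc (this.symm.trans heq)

end GenericPoints

/-! ### Finitely many distances in rigid graphs -/

namespace GraphRigidity

variable {V : Type*} {d : ℕ}

/-- The configuration with the given coordinates. -/
def ofCoords (x : V × Fin d → ℝ) : Config V d := fun a => WithLp.toLp 2 fun i => x (a, i)

/-- The coordinates of a configuration. -/
def coords (p : Config V d) : V × Fin d → ℝ := fun c => p c.1 c.2

theorem ofCoords_coords (p : Config V d) : ofCoords (coords p) = p := rfl

theorem continuous_ofCoords : Continuous (ofCoords : (V × Fin d → ℝ) → Config V d) := by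
  unfold ofCoords
  fun_prop

/-- The squared distance of `a` and `b` as a polynomial in the coordinates. -/
noncomputable def sqDist (d : ℕ) (a b : V) : MvPolynomial (V × Fin d) ℚ :=
  ∑ i, (X (a, i) - X (b, i)) ^ 2

theorem aeval_sqDist (p : Config V d) (a b : V) :
    aeval (coords p) (sqDist d a b) = ‖p a - p b‖ ^ 2 := by
  simp [sqDist, coords, EuclideanSpace.norm_sq_eq]

theorem aeval_sqDist_eq_iff (p q : Config V d) (a b : V) :
    aeval (coords q) (sqDist d a b) = aeval (coords p) (sqDist d a b) ↔
      ‖p a - p b‖ = ‖q a - q b‖ := by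
  rw [aeval_sqDist, aeval_sqDist, sq_eq_sq₀ (norm_nonneg _) (norm_nonneg _), eq_comm]

/-- In a generic framework of a rigid graph every distance takes only finitely many values among
the equivalent frameworks. -/
theorem Rigid.finite_dist [Finite V] {H : SimpleGraph V} (hH : Rigid d H) {p : Config V d}
    (hp : Generic p) (u v : V) :
    {r : ℝ | ∃ q : Config V d, Equivalent H p q ∧ ‖q u - q v‖ = r}.Finite := by
  have := Fintype.ofFinite V
  let S : Set (MvPolynomial (V × Fin d) ℚ) :=
    (fun c : V × V => sqDist d c.1 c.2) '' {c | H.Adj c.1 c.2}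
  have hS : ∀ q : Config V d, (∀ s ∈ S, aeval (coords q) s = aeval (coords p) s) ↔
      Equivalent H p q := by
    intro q
    simp only [S, Set.forall_mem_image, aeval_sqDist_eq_iff]
    exact ⟨fun h x y hxy => h (x := (x, y)) hxy, fun h c hc => h _ _ hc⟩
  have halg : IsAlgebraic (Algebra.adjoin ℚ S) (sqDist d u v) := by
    by_contra hh
    obtain ⟨ε, hε, hrig⟩ := hH p hp
    have hU : ∀ᶠ x in 𝓝 (coords p), ∀ a, ‖p a - ofCoords x a‖ < ε := by
      rw [eventually_all]
      intro a
      have hc : Continuous fun x : V × Fin d → ℝ => ‖p a - ofCoords x a‖ :=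
        (continuous_const.sub ((continuous_apply a).comp continuous_ofCoords)).norm
      refine hc.continuousAt.eventually_lt continuousAt_const ?_
      simpa [ofCoords_coords] using hε
    obtain ⟨x, hxU, hxS, hxh⟩ := hp.exists_near_of_transcendental (Set.toFinite S) hh hU
    refine hxh ((aeval_sqDist_eq_iff p (ofCoords x) u v).2 ?_)
    exact hrig (ofCoords x) ((hS (ofCoords x)).1 hxS) hxU u v
  refine ((hp.finite_values_on_fibre halg).image Real.sqrt).subset ?_
  rintro r ⟨q, hq, rfl⟩
  refine ⟨‖q u - q v‖ ^ 2, ⟨coords q, (hS q).2 hq, aeval_sqDist q u v⟩, ?_⟩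
  rw [Real.sqrt_sq (norm_nonneg _)]

/-! ### Perturbation to generic configurations -/

/-- A nonempty open interval contains a number transcendental over a given countable set. -/
theorem exists_transcendental_near {S : Set ℝ} (hS : S.Countable) (c : ℝ) {ε : ℝ} (hε : 0 < ε) :
    ∃ y : ℝ, |y - c| < ε ∧ Transcendental (Algebra.adjoin ℚ S) y := by
  have hcount : Countable (Algebra.adjoin ℚ S) := by
    rw [← Cardinal.mk_le_aleph0_iff]
    refine (Algebra.lift_cardinalMk_adjoin_le ℚ S).trans' (by simp) |>.trans ?_
    simpa using hS
  have h1 := Algebraic.countable (Algebra.adjoin ℚ S) ℝ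
  have h2 : ¬ (Set.Ioo (c - ε) (c + ε)).Countable := by
    rw [← Cardinal.le_aleph0_iff_set_countable, Cardinal.mk_Ioo_real (by linarith), not_le]
    exact Cardinal.aleph0_lt_continuum
  obtain ⟨y, hy, hy'⟩ := Set.not_subset.1 fun hsub => h2 (h1.mono hsub)
  exact ⟨y, abs_sub_lt_iff.2 ⟨by linarith [hy.2], by linarith [hy.1]⟩, hy'⟩

/-- An algebraically independent family on a subset of a finite index set extends to the whole index
set, with the new values arbitrarily close to prescribed ones. -/
theorem exists_algebraicIndependent_near {ι : Type*} [Finite ι] (x : ι → ℝ) (s : Set ι)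
    (hs : AlgebraicIndepOn ℚ x s) {ε : ℝ} (hε : 0 < ε) :
    ∃ y : ι → ℝ, (∀ i ∈ s, y i = x i) ∧ (∀ i, |y i - x i| < ε) ∧ AlgebraicIndependent ℚ y := by
  classical
  suffices h : ∀ t : Set ι, ∃ y : ι → ℝ, (∀ i ∈ s, y i = x i) ∧ (∀ i, |y i - x i| < ε) ∧
      AlgebraicIndepOn ℚ y (s ∪ t) by
    obtain ⟨y, h1, h2, h3⟩ := h Set.univ
    rw [Set.union_univ] at h3
    exact ⟨y, h1, h2,
      h3.comp (fun i => (⟨i, trivial⟩ : (Set.univ : Set ι))) fun i j hij => congrArg Subtype.val hij⟩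
  intro t
  induction t, Set.toFinite t using Set.Finite.induction_on with
  | empty => exact ⟨x, fun _ _ => rfl, fun _ => by simpa using hε, by simpa using hs⟩
  | @insert a t ha _ ih =>
    obtain ⟨y, h1, h2, h3⟩ := ih
    by_cases has : a ∈ s ∪ t
    · refine ⟨y, h1, h2, ?_⟩
      rwa [Set.union_insert, Set.insert_eq_of_mem has]
    obtain ⟨b, hb, hbt⟩ := exists_transcendental_near (Set.toFinite (y '' (s ∪ t))).countable
      (x a) hε
    have heq : ∀ i ∈ s ∪ t, Function.update y a b i = y i := fun i hi =>
      Function.update_of_ne (ne_of_mem_of_not_mem hi has) _ _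
    refine ⟨Function.update y a b, fun i hi => ?_, fun i => ?_, ?_⟩
    · rw [heq i (Or.inl hi), h1 i hi]
    · by_cases hi : i = a
      · subst hi; simpa using hb
      · rw [Function.update_of_ne hi]; exact h2 i
    · rw [Set.union_insert]
      refine AlgebraicIndepOn.insert ?_ ?_
      · have : (fun i : ↥(s ∪ t) => Function.update y a b i) = fun i : ↥(s ∪ t) => y i :=
          funext fun i => heq i i.2
        unfold AlgebraicIndepOn
        rw [this]
        exact h3
      · rw [Set.image_congr heq, Function.update_self]
        exact hbt

/-- A configuration generic on `X` can be made generic by an arbitrarily small move of the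
vertices outside `X`. -/
theorem exists_generic_near [Finite V] {p : Config V d} {X : Set V}
    (hp : Generic fun a : X => p a) {ε : ℝ} (hε : 0 < ε) :
    ∃ q : Config V d, (∀ a ∈ X, q a = p a) ∧ (∀ a i, |q a i - p a i| < ε) ∧ Generic q := by
  have hs : AlgebraicIndepOn ℚ (coords p) {c | c.1 ∈ X} := by
    have := AlgebraicIndependent.comp hp
      (fun c : {c : V × Fin d | c.1 ∈ X} => ((⟨c.1.1, c.2⟩ : X), c.1.2)) (by
        rintro ⟨⟨a, i⟩, ha⟩ ⟨⟨b, j⟩, hb⟩ h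
        simpa using h)
    exact this
  obtain ⟨y, h1, h2, h3⟩ := exists_algebraicIndependent_near _ _ hs hε
  refine ⟨ofCoords y, fun a ha => ?_, fun a i => h2 (a, i), h3⟩
  ext i
  exact h1 (a, i) ha

/-! ### The limit argument -/

/-- Globally linked vertices are joined by a path. -/
theorem GloballyLinkedIn.reachable (hd : 1 ≤ d) {G : SimpleGraph V} {p : Config V d} {u v : V}
    (h : GloballyLinkedIn G p u v) : G.Reachable u v := by
  classical
  by_contra hr
  have key : ∀ z : EuclideanSpace ℝ (Fin d), ‖p u - p v‖ = ‖z‖ := by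
    intro z
    -- Translating everything outside the component of `u` makes the difference of `u` and `v` equal
    -- to `z`.
    let q : Config V d := fun x => if G.Reachable u x then p x else p x + (p u - p v - z)
    have hq : Equivalent G p q := by
      intro x y hxy
      have hiff : G.Reachable u x ↔ G.Reachable u y :=
        ⟨fun h => h.trans hxy.reachable, fun h => h.trans hxy.symm.reachable⟩
      by_cases hx : G.Reachable u x
      · simp [q, hx, hiff.1 hx]
      · simp [q, hx, mt hiff.2 hx]
    have := h q hq
    rw [this]
    simp only [q, hr, if_false, SimpleGraph.Reachable.refl, if_true]
    congr 1
    abel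
  have h0 := key 0
  have h1 := key (EuclideanSpace.single ⟨0, hd⟩ 1)
  rw [h0] at h1
  simp at h1

/-- If `{u,v}` is globally linked in `(G, p)` and `p` is generic on the vertex set of a
`(u,v)`-rigid subgraph, then `{u,v}` is weakly globally linked in `G`. -/
theorem GloballyLinkedIn.weaklyGloballyLinked [Finite V] (hd : 1 ≤ d) {G : SimpleGraph V}
    {u v : V} {V₀ : Set V} (hV₀ : PairRigid d G V₀ u v) {p : Config V d}
    (hp : Generic fun a : V₀ => p a) (h : GloballyLinkedIn G p u v) :
    WeaklyGloballyLinked d G u v := by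
  classical
  have := Fintype.ofFinite V
  by_contra hnot
  obtain ⟨hrig, hu, hv⟩ := hV₀
  choose P hPX hPnear hPgen using fun n : ℕ =>
    exists_generic_near hp (Nat.one_div_pos_of_nat (α := ℝ) (n := n))
  have hnl : ∀ n, ∃ q : Config V d, Equivalent G (P n) q ∧ ‖P n u - P n v‖ ≠ ‖q u - q v‖ := by
    intro n
    by_contra hcon
    push Not at hcon
    exact hnot ⟨P n, hPgen n, hcon⟩
  choose Q hQ hQne using hnl
  have hPlim : ∀ a, Tendsto (fun n => P n a) atTop (𝓝 (p a)) := by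
    intro a
    have hcoord : Tendsto (fun n => (fun i => P n a i)) atTop (𝓝 fun i => p a i) := by
      rw [tendsto_pi_nhds]
      intro i
      rw [tendsto_iff_dist_tendsto_zero]
      exact squeeze_zero (fun _ => dist_nonneg) (fun n => (hPnear n a i).le)
        tendsto_one_div_add_atTop_nhds_zero_nat
    exact ((PiLp.continuous_toLp 2 fun _ : Fin d => ℝ).tendsto _).comp hcoord
  have hfin := hrig.finite_dist hp ⟨u, hu⟩ ⟨v, hv⟩
  have hmem : ∀ n, ‖Q n u - Q n v‖ ∈ {r : ℝ | ∃ q : Config V₀ d,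
      Equivalent (G.induce V₀) (fun a : V₀ => p a) q ∧
        ‖q ⟨u, hu⟩ - q ⟨v, hv⟩‖ = r} \ {‖p u - p v‖} := by
    refine fun n => ⟨⟨fun a => Q n a, fun x y hxy => ?_, rfl⟩, fun heq => ?_⟩
    · change ‖p x - p y‖ = ‖Q n x - Q n y‖
      rw [← hPX n x x.2, ← hPX n y y.2]
      exact hQ n x y hxy
    · refine hQne n ?_
      rw [hPX n u hu, hPX n v hv]
      exact (Set.mem_singleton_iff.1 heq).symm
  -- Distances inside a component stay bounded.
  have hbdd : ∀ x y, G.Reachable x y → ∃ C : ℝ, ∀ n, ‖Q n x - Q n y‖ ≤ C := by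
    rintro x y ⟨w⟩
    induction w with
    | nil => exact ⟨0, fun n => by simp⟩
    | @cons x z y hxz _ ih =>
      obtain ⟨C, hC⟩ := ih
      obtain ⟨C', hC'⟩ := (((hPlim x).sub (hPlim z)).norm).bddAbove_range
      refine ⟨C' + C, fun n => ?_⟩
      have h1 : ‖Q n x - Q n z‖ ≤ C' := (hQ n x z hxz) ▸ hC' ⟨n, rfl⟩
      calc ‖Q n x - Q n y‖ ≤ ‖Q n x - Q n z‖ + ‖Q n z - Q n y‖ := norm_sub_le_norm_sub_add_norm_sub ..
        _ ≤ C' + C := add_le_add h1 (hC n)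
  -- Pinning one representative of each component at the origin gives boundedness without changing
  -- edge lengths.
  let r : V → V := fun x => (G.connectedComponentMk x).out
  have hr : ∀ x, G.Reachable x (r x) := fun x =>
    (SimpleGraph.ConnectedComponent.exact (Quot.out_eq (G.connectedComponentMk x))).symm
  have hradj : ∀ {x y}, G.Reachable x y → r x = r y := fun hxy =>
    congrArg Quot.out (SimpleGraph.ConnectedComponent.sound hxy)
  choose C hC using fun x => hbdd x (r x) (hr x)
  let N : ℕ → Config V d := fun n x => Q n x - Q n (r x)
  have hN : ∀ n x y, G.Reachable x y → N n x - N n y = Q n x - Q n y := by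
    intro n x y hxy
    simp only [N, hradj hxy]
    abel
  have hNbdd : Bornology.IsBounded (Set.range N) := by
    rw [Bornology.forall_isBounded_image_eval_iff.symm]
    intro x
    refine (Metric.isBounded_closedBall (x := 0) (r := C x)).subset ?_
    rintro _ ⟨_, ⟨n, rfl⟩, rfl⟩
    simpa using hC x n
  obtain ⟨q, -, φ, hφ, hlim⟩ := tendsto_subseq_of_bounded hNbdd (fun n => Set.mem_range_self n)
  have hqlim : ∀ x y, Tendsto (fun n => ‖N (φ n) x - N (φ n) y‖) atTop (𝓝 ‖q x - q y‖) :=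
    fun x y => (((tendsto_pi_nhds.1 hlim x).sub (tendsto_pi_nhds.1 hlim y)).norm)
  have hequiv : Equivalent G p q := by
    intro x y hxy
    refine tendsto_nhds_unique (((hPlim x).sub (hPlim y)).norm.comp hφ.tendsto_atTop) ?_
    refine (hqlim x y).congr fun n => ?_
    rw [hN _ _ _ hxy.reachable]
    exact (hQ (φ n) x y hxy).symm
  -- A finite set is closed, so the limit distance still differs from `‖p u - p v‖`.
  have hqmem := (hfin.subset (Set.sdiff_subset (t := {‖p u - p v‖}))).isClosed.mem_of_tendsto
    (hqlim u v) (Eventually.of_forall fun n => by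
      rw [hN _ _ _ (h.reachable hd)]; exact hmem (φ n))
  exact hqmem.2 (h q hequiv).symm

/-! ### Pulling back along the contraction -/

theorem Generic.comp {W : Type*} {p : Config V d} (hp : Generic p) {f : W → V}
    (hf : Function.Injective f) : Generic fun a => p (f a) :=
  AlgebraicIndependent.comp hp (Prod.map f id) (hf.prodMap Function.injective_id)

theorem injective_contractMk {s₁ s₂ : V} {X : Set V} (hX : ¬ (s₁ ∈ X ∧ s₂ ∈ X)) :
    Function.Injective fun a : X => contractMk {s₁, s₂} (a : V) := by
  intro a b hab
  have hab' : (a : V) = b ∨ ((a : V) ∈ ({s₁, s₂} : Set V) ∧ (b : V) ∈ ({s₁, s₂} : Set V)) :=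
    Quotient.exact hab
  rcases hab' with h | ⟨h1 | h1, h2 | h2⟩
  · exact Subtype.ext h
  · exact Subtype.ext (h1.trans h2.symm)
  · exact absurd ⟨h1 ▸ a.2, h2 ▸ b.2⟩ hX
  · exact absurd ⟨h2 ▸ b.2, h1 ▸ a.2⟩ hX
  · exact Subtype.ext (h1.trans h2.symm)

/-- Pulling a framework of a contraction back to the graph keeps a pair globally linked when
the contracted vertices are adjacent. -/
theorem GloballyLinkedIn.of_contract {G : SimpleGraph V} {s₁ s₂ u v : V} (he : G.Adj s₁ s₂)
    {p : Config (ContractVertex {s₁, s₂}) d}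
    (h : GloballyLinkedIn (contract G {s₁, s₂}) p
      (contractMk {s₁, s₂} u) (contractMk {s₁, s₂} v)) :
    GloballyLinkedIn G (fun x => p (contractMk {s₁, s₂} x)) u v := by
  intro q hq
  have hmk : contractMk {s₁, s₂} s₁ = contractMk {s₁, s₂} s₂ :=
    Quotient.sound (Or.inr ⟨by simp, by simp⟩)
  have hs : q s₁ = q s₂ := by
    have := hq s₁ s₂ he
    beta_reduce at this
    rw [hmk, sub_self, norm_zero, eq_comm, norm_eq_zero, sub_eq_zero] at this
    exact this
  let q' : Config (ContractVertex {s₁, s₂}) d := Quotient.lift q (by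
    rintro a b (rfl | ⟨ha, hb⟩)
    · rfl
    · rcases ha with rfl | rfl <;> rcases hb with rfl | rfl <;> simp [hs])
  refine h q' ?_
  rintro _ _ ⟨-, x, y, hxy, rfl, rfl⟩
  exact hq x y hxy

end GraphRigidity

theorem mainTheorem5 {V : Type*} [Finite V] (d : ℕ) (hd : 1 ≤ d)
    (G : SimpleGraph V) (u v : V) (V₀ : Set V)
    (hV₀ : GraphRigidity.PairRigid d G V₀ u v)
    (s₁ s₂ : V) (he : G.Adj s₁ s₂) (heV₀ : ¬ (s₁ ∈ V₀ ∧ s₂ ∈ V₀))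
    (hlinked : GraphRigidity.WeaklyGloballyLinked d
      (GraphRigidity.contract G {s₁, s₂})
      (GraphRigidity.contractMk {s₁, s₂} u) (GraphRigidity.contractMk {s₁, s₂} v)) :
    GraphRigidity.WeaklyGloballyLinked d G u v := by
  obtain ⟨p, hp, hlink⟩ := hlinked
  obtain ⟨p', hp', hlink'⟩ : ∃ p' : GraphRigidity.Config V d,
      GraphRigidity.Generic (fun a : V₀ => p' a) ∧ GraphRigidity.GloballyLinkedIn G p' u v :=
    ⟨fun x => p (GraphRigidity.contractMk {s₁, s₂} x),
      hp.comp (GraphRigidity.injective_contractMk heV₀), hlink.of_contract he⟩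
  exact hlink'.weaklyGloballyLinked hd hV₀ hp'
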